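/- Let $P\subset\mathbb{R}^3$ be a polyhedron of genus $g$: a compact solid, equal to the closure of its interior, whose boundary is a connected closed polyhedral surface of genus $g$ (i.e. of Euler characteristic $2-2g$), with the boundary divided into finitely many flat polygonal facets (not necessarily convex or simply connected, but each with connected relative interior). Two distinct facets are neighbors if they have a common edge. A finger of $P$ is a pair $(f_b,f_t)$ of neighboring facets (the base facets of its body and of its fingertip). It extends the palm based on a facet $f_p$ if $f_p$ and $f_b$ are neighbors and $f_t\ne f_p$. A fixture of $P$ consists of a palm and finitely many fingers that extend it, distinct fingers having distinct body facets. A candidate finger is a finger that belongs to at least one fixture of $P$. Lemma. Let $\tau$ be a triplet of candidate fingers of $P$ whose three body facets are pairwise distinct, and let $\mathcal{P}$ be the set of all palms (equivalently, of their base facets) that are extended by every finger in $\tau$. Then $|\mathcal{P}|\le 4g+2$. -/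

import Mathlib

noncomputable section

namespace SnappingFixture

/-- Euclidean three-space. -/
abbrev E3 : Type := EuclideanSpace ℝ (Fin 3)

/-- The simplices of `K` with exactly `k` vertices: vertices, edges and triangles of `K` for
`k = 1, 2, 3`. -/
def simplices (K : Geometry.SimplicialComplex ℝ E3) (k : ℕ) : Set (Finset E3) :=
  {s | s ∈ K.faces ∧ s.card = k}

/-- Two simplices have a common edge. -/
def SharesEdge (s t : Finset E3) : Prop :=
  ∃ e : Finset E3, e.card = 2 ∧ e ⊆ s ∧ e ⊆ t

/-- Any two triangles of the set `A` are joined by a chain of triangles of `A` in which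
consecutive triangles have a common edge. -/
def EdgeConnected (A : Set (Finset E3)) : Prop :=
  ∀ s ∈ A, ∀ t ∈ A,
    Relation.ReflTransGen (fun a b => a ∈ A ∧ b ∈ A ∧ SharesEdge a b) s t

/-- `K` is a triangulated connected closed surface: a finite complex in which every simplex is a
face of a triangle, every edge lies in exactly two triangles, the triangles around each vertex
form a single cycle (given the edge condition, this says that they are edge-connected),
and whose underlying space is connected. -/
structure IsClosedSurface (K : Geometry.SimplicialComplex ℝ E3) : Prop where
  finite : K.faces.Finite
  pure : ∀ s ∈ K.faces, ∃ t ∈ simplices K 3, s ⊆ t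
  edge : ∀ e ∈ simplices K 2, {t ∈ simplices K 3 | e ⊆ t}.ncard = 2
  star : ∀ v : E3, EdgeConnected {t ∈ simplices K 3 | v ∈ t}
  connected : IsConnected K.space

/-- A polyhedron in three-space: a compact solid, equal to the closure of its interior, whose
boundary is a connected closed polyhedral surface (given with a triangulation), together with its
facets.  A facet is recorded as the set of the boundary triangles that it consists of: the
facets partition the boundary into flat pieces, each connected through edges.
Facets may be non-convex and may have holes, and
coplanar facets may (but need not) be merged into one. -/
structure Polyhedron where
  carrier : Set E3
  isCompact_carrier : IsCompact carrier
  closure_interior : closure (interior carrier) = carrier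
  bd : Geometry.SimplicialComplex ℝ E3
  frontier_eq : frontier carrier = bd.space
  isClosedSurface : IsClosedSurface bd
  facets : Set (Set (Finset E3))
  sUnion_facets : ⋃₀ facets = simplices bd 3
  pairwiseDisjoint_facets : facets.PairwiseDisjoint id
  nonempty_of_facet : ∀ f ∈ facets, f.Nonempty
  coplanar_of_facet : ∀ f ∈ facets, Coplanar ℝ (⋃ t ∈ f, (t : Set E3))
  edgeConnected_of_facet : ∀ f ∈ facets, EdgeConnected f

namespace Polyhedron

variable (P : Polyhedron)

/-- The Euler characteristic `V - E + F` of the boundary surface, counted on its triangulation. -/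
def eulerChar : ℤ :=
  (simplices P.bd 1).ncard - (simplices P.bd 2).ncard + (simplices P.bd 3).ncard

/-- `P` has genus `g`: the boundary, a connected closed surface in three-space (hence
orientable), has Euler characteristic `2 - 2g`. -/
def HasGenus (g : ℕ) : Prop := P.eulerChar = 2 - 2 * (g : ℤ)

/-- The facets of `P`, as a type. -/
abbrev Facet : Type := {f : Set (Finset E3) // f ∈ P.facets}

variable {P}

/-- Two facets are neighbors: they are distinct and have a common edge. -/
def Facet.Neighbor (f f' : P.Facet) : Prop :=
  f ≠ f' ∧ ∃ s ∈ f.1, ∃ t ∈ f'.1, SharesEdge s t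

variable (P)

/-- A finger of spreading degree two: the base facet of its body and a neighboring facet, on which
its fingertip is based. -/
structure Finger where
  body : P.Facet
  tip : P.Facet
  neighbor : body.Neighbor tip

variable {P}

/-- The finger `F` extends the palm based on the facet `p`: the body is based on a neighbor of
`p`, and the fingertip is not based on `p`. -/
def Finger.Extends (F : P.Finger) (p : P.Facet) : Prop :=
  p.Neighbor F.body ∧ F.tip ≠ p

variable (P)

/-- A snapping fixture of `P`, given by the base facet of its palm and its fingers; all fingers
extend the palm.  The bodies of distinct fingers are disjoint parts of the fixture, so they are
based on distinct facets. -/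
structure Fixture where
  palm : P.Facet
  fingers : Finset P.Finger
  extends_palm : ∀ F ∈ fingers, F.Extends palm
  bodies_distinct : ∀ F ∈ fingers, ∀ F' ∈ fingers, F.body = F'.body → F = F'

variable {P}

/-- A candidate finger of `P` is a finger of at least one possible fixture of `P`. -/
def Finger.IsCandidate (F : P.Finger) : Prop :=
  ∃ G : P.Fixture, F ∈ G.fingers

/-- The base facets of the palms that are extended by all three fingers of the triplet `τ`. -/
def commonPalms (τ : Fin 3 → P.Finger) : Set P.Facet :=
  {p | ∀ i, (τ i).Extends p}

end Polyhedron

end SnappingFixture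

end

/-! The three bodies and their common palms are disjoint connected parts of the dual graph of the
triangulated boundary, forming a `K_{3,n}` minor; the claim is the Euler bound for such a minor in
girth four. No embedding theory is used, only counting over `ZMod 2`
(`card_le_of_dual_completeBipartite_minor`). Enlarge the parts to a partition of all triangles, keep
a spanning forest inside the parts and one crossing edge per pair, and identify vertices along all
other edges. The classes `Y` play the role of the faces of `K_{3,n}`. Rank bounds give `2n ≤ |Y| + 1
+ 2g`. If `|Y| > 1`, the coboundary of a class restricts to a nonzero even subgraph of `K_{3,n}`,
with at least four edges, and each of the `3n` edges serves at most two classes. So `4|Y| ≤ 6n`,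
whence `n ≤ 4g + 2`. -/

/-! ### Incidence ranks, connected partitions and even bipartite graphs -/

/-- If every fibre of `π` is connected through the edges `u i`, `w i`, then the number of edges is
at least the rank of their incidence matrix, which is at least `|X| - |Y|`. -/
theorem card_le_rank_incidence_add_card {X Y ι : Type*} [Fintype X] [Fintype Y] [Fintype ι]
    [DecidableEq X] (u w : ι → X) (π : X → Y)
    (hπ : ∀ S : X → Prop, (∀ i, S (u i) ↔ S (w i)) → ∀ s t, π s = π t → S s → S t) :
    Fintype.card X ≤
      (Matrix.of fun i => (Pi.single (u i) 1 + Pi.single (w i) 1 : X → ZMod 2)).rank +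
        Fintype.card Y := by
  classical
  set M := Matrix.of fun i => (Pi.single (u i) 1 + Pi.single (w i) 1 : X → ZMod 2) with hM
  have hrn := M.mulVecLin.finrank_range_add_finrank_ker
  rw [Module.finrank_fintype_fun_eq_card] at hrn
  -- A kernel vector agrees at the two ends of each edge, so it is constant on fibres and factors
  -- through `π`.
  have hle : LinearMap.ker M.mulVecLin ≤ LinearMap.range (LinearMap.funLeft (ZMod 2) (ZMod 2) π) := by
    intro φ hφ
    have hφ' : ∀ i, φ (u i) = φ (w i) := by
      intro i
      have h := congrFun (LinearMap.mem_ker.mp hφ) i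
      simp only [Matrix.mulVecLin_apply, Matrix.mulVec, hM, Matrix.of_apply, add_dotProduct,
        single_one_dotProduct, Pi.zero_apply] at h
      exact (CharTwo.add_eq_zero).mp h
    refine ⟨Function.extend π φ 0, ?_⟩
    ext s
    have hfac : Function.FactorsThrough φ π := by
      intro s t hst
      exact (hπ (fun z => φ s = φ z) (fun i => by rw [hφ' i]) s t hst rfl)
    simpa [LinearMap.funLeft_apply] using hfac.extend_apply 0 s
  have h1 := Submodule.finrank_mono hle
  have h2 := LinearMap.finrank_range_le (LinearMap.funLeft (ZMod 2) (ZMod 2) π)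
  rw [Module.finrank_fintype_fun_eq_card] at h2
  have : M.rank = Module.finrank (ZMod 2) (LinearMap.range M.mulVecLin) := rfl
  omega

/-- Disjoint connected parts of a connected graph extend to a partition into connected parts. -/
theorem exists_extend_connected_partition {E T I : Type*} [Finite T] (l r : E → T)
    (hconn : ∀ S : T → Prop, (∀ e, S (l e) ↔ S (r e)) → ∀ s t, S s → S t)
    (p : T → Option I) (hne : ∃ t, (p t).isSome)
    (hp : ∀ i, ∀ S : T → Prop,
      (∀ e, p (l e) = some i → p (r e) = some i → (S (l e) ↔ S (r e))) →
        ∀ s t, p s = some i → p t = some i → S s → S t) :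
    ∃ π : T → I, (∀ t i, p t = some i → π t = i) ∧
      ∀ S : T → Prop, (∀ e, π (l e) = π (r e) → (S (l e) ↔ S (r e))) →
        ∀ s t, π s = π t → S s → S t := by
  classical
  induction hn : {t | p t = none}.ncard generalizing p with
  | zero =>
    have hall : ∀ t, p t ≠ none := by
      intro t ht
      have := (Set.ncard_eq_zero (Set.toFinite _)).mp hn
      exact Set.notMem_empty t (this ▸ ht)
    choose π hπ using fun t => Option.ne_none_iff_exists'.mp (hall t)
    refine ⟨π, fun t i h => by simpa [hπ t] using h, fun S hS s t hst => ?_⟩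
    refine hp (π s) S (fun e h1 h2 => hS e ?_) s t (hπ s) (by rw [hπ t, hst])
    rw [hπ] at h1 h2
    exact (Option.some.inj h1).trans (Option.some.inj h2).symm
  | succ n ih =>
    have hout : ∃ t, p t = none := by
      by_contra! h
      have : {t | p t = none} = ∅ := by ext t; simp [h t]
      simp [this] at hn
    -- Otherwise the assigned elements would be closed under adjacency, against connectedness. The
    -- outer end of such an edge then joins the part of the inner end.
    have hcross : ∃ t₀ t₁ i, p t₀ = some i ∧ p t₁ = none ∧
        ∃ e, (l e = t₀ ∧ r e = t₁) ∨ (l e = t₁ ∧ r e = t₀) := by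
      by_contra! hcon
      obtain ⟨t₁, ht₁⟩ := hout
      obtain ⟨t₀, ht₀⟩ := hne
      have := hconn (fun t => (p t).isSome) (fun e => ?_) t₀ t₁ ht₀
      · simp [ht₁] at this
      · cases hl : p (l e) with
        | none => cases hr : p (r e) with
          | none => simp
          | some i => exact absurd rfl ((hcon (r e) (l e) i hr hl e).2 rfl)
        | some i => cases hr : p (r e) with
          | none => exact absurd rfl ((hcon (l e) (r e) i hl hr e).1 rfl)
          | some j => simp
    obtain ⟨t₀, t₁, i, ht₀, ht₁, e₀, he₀⟩ := hcross
    have hne01 : t₀ ≠ t₁ := by rintro rfl; simp [ht₀] at ht₁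
    have hold : ∀ t j, p t = some j → Function.update p t₁ (some i) t = some j := by
      intro t j h
      rw [Function.update_of_ne (by rintro rfl; simp [ht₁] at h), h]
    obtain ⟨π, hπ, hc⟩ := ih (Function.update p t₁ (some i)) ⟨t₁, by simp⟩ (by
      intro j S hS
      have key : ∀ s t, p s = some j → p t = some j → S s → S t :=
        hp j S fun e h1 h2 => hS e (hold _ _ h1) (hold _ _ h2)
      have h01 : j = i → (S t₀ ↔ S t₁) := by
        rintro rfl
        have h0 := hold _ _ ht₀
        have h1 : Function.update p t₁ (some j) t₁ = some j := by simp
        rcases he₀ with ⟨rfl, rfl⟩ | ⟨rfl, rfl⟩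
        · exact hS e₀ h0 h1
        · exact (hS e₀ h1 h0).symm
      intro s t hs ht
      by_cases hs1 : s = t₁ <;> by_cases ht1 : t = t₁
      · rw [hs1, ht1]; exact id
      · subst hs1
        rw [Function.update_self] at hs
        rw [Function.update_of_ne ht1] at ht
        obtain rfl := Option.some.inj hs
        exact fun h => key _ _ ht₀ ht ((h01 rfl).2 h)
      · subst ht1
        rw [Function.update_self] at ht
        rw [Function.update_of_ne hs1] at hs
        obtain rfl := Option.some.inj ht
        exact fun h => (h01 rfl).1 (key _ _ hs ht₀ h)
      · rw [Function.update_of_ne ht1] at ht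
        rw [Function.update_of_ne hs1] at hs
        exact key _ _ hs ht) (by
      have : {t | Function.update p t₁ (some i) t = none} = {t | p t = none} \ {t₁} := by
        ext t
        by_cases h : t = t₁ <;> simp [h]
      rw [this, Set.ncard_sdiff_singleton_of_mem (by exact ht₁), hn]
      rfl)
    exact ⟨π, fun t j h => hπ t j (hold t j h), hc⟩

theorem exists_ne_apply_ne_zero_of_sum_eq_zero {K R : Type*} [Fintype K] [AddCommMonoid R]
    (f : K → R) (hf : ∑ k, f k = 0) {k : K} (hk : f k ≠ 0) : ∃ k', k' ≠ k ∧ f k' ≠ 0 := by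
  by_contra! h
  rw [Fintype.sum_eq_single k h] at hf
  exact hk hf

/-- A nonzero matrix over `ZMod 2` with zero row and column sums has at least four nonzero
entries. -/
theorem four_le_card_support_of_sum_eq_zero {I J : Type*} [Fintype I] [Fintype J]
    (M : I → J → ZMod 2) (hrow : ∀ i, ∑ j, M i j = 0) (hcol : ∀ j, ∑ i, M i j = 0)
    (hM : ∃ i j, M i j ≠ 0) :
    4 ≤ (Finset.univ.filter fun q : I × J => M q.1 q.2 ≠ 0).card := by
  classical
  obtain ⟨i, j, hij⟩ := hM
  obtain ⟨j', hj', hij'⟩ := exists_ne_apply_ne_zero_of_sum_eq_zero _ (hrow i) hij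
  obtain ⟨i', hi', hi'j⟩ := exists_ne_apply_ne_zero_of_sum_eq_zero _ (hcol j) hij
  obtain ⟨i'', hi'', hi''j'⟩ := exists_ne_apply_ne_zero_of_sum_eq_zero _ (hcol j') hij'
  -- `i'` and `i''` may coincide; the four positions are distinct anyway.
  have hsub : ({(i, j), (i, j'), (i', j), (i'', j')} : Finset (I × J)) ⊆
      Finset.univ.filter fun q : I × J => M q.1 q.2 ≠ 0 := by
    intro q hq
    simp only [Finset.mem_insert, Finset.mem_singleton] at hq
    rcases hq with rfl | rfl | rfl | rfl <;> simpa
  refine le_trans (le_of_eq ?_) (Finset.card_le_card hsub)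
  rw [Finset.card_insert_of_notMem, Finset.card_insert_of_notMem, Finset.card_insert_of_notMem,
    Finset.card_singleton]
  · simp [hj'.symm]
  · simp [hi'.symm, hi''.symm]
  · simp [hj'.symm, hi'.symm]

/-! ### The Euler bound for `K_{3,n}` minors -/

/-- The Euler bound for `K_{3,J}` minors: for a cell decomposition of a surface with vertices `V`,
edges `E` and faces `T`, given by the end points `a e`, `b e` of each edge and the faces `l e`, `r e`
on its two sides, if the dual graph has disjoint connected parts indexed by `Fin 3 ⊕ J` in which any
part of the first kind is adjacent to any part of the second kind, then `|J| ≤ 4 g + 2`, where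
`2 - 2 g` is the Euler characteristic. -/
theorem card_le_of_dual_completeBipartite_minor {V E T J : Type*} [Fintype V] [Fintype E]
    [Fintype T] [Fintype J] [DecidableEq T] (a b : E → V) (l r : E → T) (g : ℕ)
    (hchar : (Fintype.card V : ℤ) - Fintype.card E + Fintype.card T = 2 - 2 * (g : ℤ))
    (hconnV : ∀ S : V → Prop, (∀ e, S (a e) ↔ S (b e)) → ∀ s t, S s → S t)
    (hconnT : ∀ S : T → Prop, (∀ e, S (l e) ↔ S (r e)) → ∀ s t, S s → S t)
    (heven : ∀ (φ : V → ZMod 2) (t : T), ∑ e, (φ (a e) + φ (b e)) *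
      ((if l e = t then 1 else 0) + (if r e = t then 1 else 0)) = 0)
    (p : T → Option (Fin 3 ⊕ J))
    (hp : ∀ i, ∀ S : T → Prop,
      (∀ e, p (l e) = some i → p (r e) = some i → (S (l e) ↔ S (r e))) →
        ∀ s t, p s = some i → p t = some i → S s → S t)
    (hx : ∀ i j, ∃ e, (p (l e) = some (.inl i) ∧ p (r e) = some (.inr j)) ∨
      (p (l e) = some (.inr j) ∧ p (r e) = some (.inl i))) :
    Fintype.card J ≤ 4 * g + 2 := by
  classical
  cases isEmpty_or_nonempty J with
  | inl h => simp
  | inr hJ =>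
  obtain ⟨j₀⟩ := hJ
  have hne : ∃ t, (p t).isSome := by
    obtain ⟨e, h | h⟩ := hx 0 j₀ <;> exact ⟨l e, by simp [h.1]⟩
  obtain ⟨π, hπp, hπ⟩ := exists_extend_connected_partition l r hconnT p hne hp
  choose x hx using hx
  have hxπ : ∀ i j, (π (l (x i j)) = .inl i ∧ π (r (x i j)) = .inr j) ∨
      (π (l (x i j)) = .inr j ∧ π (r (x i j)) = .inl i) := fun i j =>
    (hx i j).imp (fun h => ⟨hπp _ _ h.1, hπp _ _ h.2⟩) (fun h => ⟨hπp _ _ h.1, hπp _ _ h.2⟩)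
  let X : Fin 3 × J → E := fun q => x q.1 q.2
  have hXinj : Function.Injective X := by
    rintro ⟨i, j⟩ ⟨i', j'⟩ (h : x i j = x i' j')
    have h1 := hxπ i j
    have h2 := hxπ i' j'
    rw [h] at h1
    rcases h1 with h1 | h1 <;> rcases h2 with h2 | h2
    · exact Prod.ext (Sum.inl.inj (h1.1.symm.trans h2.1)) (Sum.inr.inj (h1.2.symm.trans h2.2))
    · exact absurd (h1.1.symm.trans h2.1) Sum.inl_ne_inr
    · exact absurd (h1.1.symm.trans h2.1) Sum.inr_ne_inl
    · exact Prod.ext (Sum.inl.inj (h1.2.symm.trans h2.2)) (Sum.inr.inj (h1.1.symm.trans h2.1))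
  have hXout : ∀ q, π (l (X q)) ≠ π (r (X q)) := by
    intro q
    rcases hxπ q.1 q.2 with h | h <;> simp [X, h.1, h.2]
  -- A maximal independent set of edges inside the parts.
  let ι := {e : E // π (l e) = π (r e)}
  let vec : ι → T → ZMod 2 := fun e => Pi.single (l e.1) 1 + Pi.single (r e.1) 1
  obtain ⟨κ, f, hf, hspan, hli⟩ := exists_linearIndependent' (ZMod 2) vec
  have : Finite κ := Finite.of_injective f hf
  have : Fintype κ := Fintype.ofFinite κ
  have hκ : Fintype.card T ≤ Fintype.card κ + (3 + Fintype.card J) := by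
    have h := card_le_rank_incidence_add_card (ι := ι) (fun e => l e.1) (fun e => r e.1) π
      (fun S hS => hπ S fun e he => hS ⟨e, he⟩)
    rw [Matrix.rank_eq_finrank_span_row] at h
    have h3 : Module.finrank (ZMod 2) (Submodule.span (ZMod 2) (Set.range vec)) =
        Fintype.card κ := by
      rw [← hspan, finrank_span_eq_card hli]
    have h4 : Fintype.card (Fin 3 ⊕ J) = 3 + Fintype.card J := by simp
    rw [h4] at h
    exact h.trans (by rw [← h3]; rfl)
  -- The vertices, modulo the edges that do not meet the minor.
  let H : κ ⊕ Fin 3 × J → E := Sum.elim (fun k => (f k).1) X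
  have hHinj : Function.Injective H := by
    refine Function.Injective.sumElim (Subtype.val_injective.comp hf) hXinj ?_
    intro k q h
    exact hXout q (h ▸ (f k).2)
  let R : V → V → Prop := fun v w => ∃ e, e ∉ Set.range H ∧ a e = v ∧ b e = w
  let Y := Quot R
  let mk : V → Y := Quot.mk R
  have : Finite Y := Finite.of_surjective mk Quot.mk_surjective
  have : Fintype Y := Fintype.ofFinite Y
  let ι' := {e : E // e ∉ Set.range H}
  -- Each identified edge merges at most two classes: here the rank is bounded by the number of
  -- rows.
  have hY : Fintype.card V ≤ Fintype.card ι' + Fintype.card Y := by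
    refine (card_le_rank_incidence_add_card (ι := ι') (fun e => a e.1) (fun e => b e.1) mk
      ?_).trans (Nat.add_le_add_right (Matrix.rank_le_card_height _) _)
    intro S hS s t hst
    have hR : ∀ v w, R v w → S v = S w := by
      rintro v w ⟨e, he, rfl, rfl⟩
      exact propext (hS ⟨e, he⟩)
    exact (congrArg (Quot.lift S hR) hst).mp
  have hι' : Fintype.card ι' + (Fintype.card κ + 3 * Fintype.card J) = Fintype.card E := by
    have h1 : Fintype.card {e : E // e ∈ Set.range H} = Fintype.card κ + 3 * Fintype.card J := by
      rw [← Fintype.card_congr (Equiv.ofInjective H hHinj)]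
      simp
    have h2 := Fintype.card_subtype_compl fun e => e ∈ Set.range H
    have h3 := Fintype.card_subtype_le fun e => e ∈ Set.range H
    change Fintype.card ι' = _ at h2
    omega
  -- Substitute `hκ`, `hY` and `hι'` into the Euler characteristic.
  have hcY : 2 * (Fintype.card J : ℤ) ≤ Fintype.card Y + 1 + 2 * g := by omega
  by_cases hY1 : Fintype.card Y ≤ 1
  · omega
  -- The coboundary of a class of vertices.
  let φ : Y → V → ZMod 2 := fun y v => if mk v = y then 1 else 0
  let δ : Y → E → ZMod 2 := fun y e => φ y (a e) + φ y (b e)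
  have hδ0 : ∀ y e, e ∉ Set.range H → δ y e = 0 := by
    intro y e he
    have : mk (a e) = mk (b e) := Quot.sound ⟨e, he, rfl, rfl⟩
    simp only [δ, φ, this]
    exact CharTwo.add_self_eq_zero _
  -- With zero coboundary, a class would contain every vertex by connectedness, but there are at
  -- least two classes.
  have hδne : ∀ y, ∃ e, δ y e ≠ 0 := by
    intro y
    by_contra! h
    have hy : ∀ s t, mk s = y → mk t = y := by
      refine hconnV _ fun e => ?_
      have h' : (if mk (a e) = y then (1 : ZMod 2) else 0) = if mk (b e) = y then 1 else 0 :=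
        CharTwo.add_eq_zero.mp (h e)
      split_ifs at h' with h1 h2 h2
      · exact iff_of_true h1 h2
      · exact absurd h' one_ne_zero
      · exact absurd h' zero_ne_one
      · exact iff_of_false h1 h2
    obtain ⟨v, hv⟩ := Quot.mk_surjective y
    refine hY1 (Fintype.card_le_one_iff.mpr fun y₁ y₂ => ?_)
    obtain ⟨v₁, rfl⟩ := Quot.mk_surjective y₁
    obtain ⟨v₂, rfl⟩ := Quot.mk_surjective y₂
    exact (hy v v₁ hv).trans (hy v v₂ hv).symm
  -- A coboundary vanishing on the crossing edges lives on the forest, where `heven` becomes a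
  -- linear relation among independent incidence vectors.
  have hδX : ∀ y, ∃ q, δ y (X q) ≠ 0 := by
    intro y
    by_contra! h
    have hsum : ∑ k, δ y (f k).1 • (vec ∘ f) k = 0 := by
      ext t
      rw [Finset.sum_apply]
      refine Eq.trans ?_ (heven (φ y) t)
      refine Fintype.sum_of_injective (fun k => (f k).1) (Subtype.val_injective.comp hf) _ _
        (fun e he => ?_) (fun k => ?_)
      · suffices δ y e = 0 by
          change δ y e * _ = 0
          rw [this, zero_mul]
        by_cases heH : e ∈ Set.range H
        · obtain ⟨k | q, rfl⟩ := heH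
          · exact absurd ⟨k, rfl⟩ he
          · exact h q
        · exact hδ0 y e heH
      · simp only [vec, Function.comp, Pi.smul_apply, Pi.add_apply, smul_eq_mul, Pi.single_apply,
          δ, eq_comm]
    obtain ⟨e, he⟩ := hδne y
    by_cases heH : e ∈ Set.range H
    · obtain ⟨k | q, rfl⟩ := heH
      · exact he (Fintype.linearIndependent_iff.mp hli _ hsum k)
      · exact he (h q)
    · exact he (hδ0 y e heH)
  -- Sum `heven` over the triangles of a part: edges inside a part cancel modulo two, and only
  -- crossing edges survive.
  have hpart : ∀ y k, ∑ q : Fin 3 × J, δ y (X q) *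
      ((if Sum.inl q.1 = k then 1 else 0) + (if Sum.inr q.2 = k then 1 else 0)) = 0 := by
    intro y k
    have h0 : ∑ e, δ y e * ((if π (l e) = k then 1 else 0) + (if π (r e) = k then 1 else 0)) = 0 := by
      have h : ∑ t, (if π t = k then 1 else 0) * ∑ e, δ y e *
          ((if l e = t then 1 else 0) + (if r e = t then 1 else 0)) = 0 :=
        Finset.sum_eq_zero fun t _ => by rw [heven (φ y) t, mul_zero]
      simp_rw [Finset.mul_sum] at h
      rw [Finset.sum_comm] at h
      refine Eq.trans (Finset.sum_congr rfl fun e _ => ?_) h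
      simp only [mul_add, Finset.sum_add_distrib, mul_ite, mul_one, mul_zero, Finset.sum_ite_eq,
        Finset.mem_univ, if_true]
      simp only [ite_mul, one_mul, zero_mul]
    refine Eq.trans ?_ h0
    refine Fintype.sum_of_injective X hXinj _ _ (fun e he => ?_) (fun q => ?_)
    · by_cases heH : e ∈ Set.range H
      · obtain ⟨k' | q, rfl⟩ := heH
        · have : π (l (H (.inl k'))) = π (r (H (.inl k'))) := (f k').2
          rw [this, CharTwo.add_self_eq_zero, mul_zero]
        · exact absurd ⟨q, rfl⟩ he
      · rw [hδ0 y e heH, zero_mul]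
    · rcases hxπ q.1 q.2 with h | h <;> simp only [X, h.1, h.2]
      rw [add_comm]
  have hfour : ∀ y, 4 ≤ (Finset.univ.filter fun q => δ y (X q) ≠ 0).card := by
    intro y
    refine four_le_card_support_of_sum_eq_zero (fun i j => δ y (X (i, j))) (fun i => ?_)
      (fun j => ?_) ?_
    · have h := hpart y (.inl i)
      rw [Fintype.sum_prod_type] at h
      simpa [← Finset.sum_mul] using h
    · have h := hpart y (.inr j)
      rw [Fintype.sum_prod_type_right] at h
      simpa [← Finset.sum_mul] using h
    · obtain ⟨q, hq⟩ := hδX y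
      exact ⟨q.1, q.2, hq⟩
  have htwo : ∀ q, (Finset.univ.filter fun y => δ y (X q) ≠ 0).card ≤ 2 := by
    intro q
    refine (Finset.card_le_card (t := {mk (a (X q)), mk (b (X q))}) fun y hy => ?_).trans
      Finset.card_le_two
    by_contra hcon
    simp only [Finset.mem_insert, Finset.mem_singleton, not_or] at hcon
    simp [δ, φ, Ne.symm hcon.1, Ne.symm hcon.2] at hy
  have hcount : Fintype.card Y * 4 ≤ Fintype.card (Fin 3 × J) * 2 := by
    have := Finset.card_nsmul_le_card_nsmul (s := (Finset.univ : Finset Y))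
      (t := (Finset.univ : Finset (Fin 3 × J))) (fun y q => δ y (X q) ≠ 0) (m := 4) (n := 2)
      (fun y _ => hfour y) (fun q _ => htwo q)
    simpa using this
  simp only [Fintype.card_prod, Fintype.card_fin] at hcount
  omega

/-! ### Connectivity and incidences of closed surfaces -/

open Geometry

namespace SnappingFixture

variable {K : SimplicialComplex ℝ E3}

namespace IsClosedSurface

theorem finite_simplices (hK : IsClosedSurface K) (k : ℕ) : (simplices K k).Finite :=
  hK.finite.subset fun _ h => h.1

/-- Moving across edges, one reaches all triangles of a closed surface. -/
theorem dual_connected (hK : IsClosedSurface K) (S : Finset E3 → Prop)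
    (hS : ∀ s ∈ simplices K 3, ∀ t ∈ simplices K 3, SharesEdge s t → (S s ↔ S t)) :
    ∀ s ∈ simplices K 3, ∀ t ∈ simplices K 3, S s → S t := by
  intro s₀ hs₀ t₀ ht₀ hSs
  by_contra hSt
  -- The star condition upgrades invariance across edges to invariance across vertices.
  have hvertex : ∀ v, ∀ s ∈ simplices K 3, ∀ t ∈ simplices K 3, v ∈ s → v ∈ t → S s → S t := by
    intro v s hs t ht hvs hvt h
    have hst := hK.star v s ⟨hs, hvs⟩ t ⟨ht, hvt⟩
    clear ht hvt
    induction hst with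
    | refl => exact h
    | tail _ hbc ih => exact (hS _ hbc.1.1 _ hbc.2.1.1 hbc.2.2).mp ih
  have hclosed : ∀ Q : Finset E3 → Prop,
      IsClosed (⋃ t ∈ {t ∈ simplices K 3 | Q t}, convexHull ℝ (t : Set E3)) := fun Q =>
    ((hK.finite_simplices 3).subset fun _ h => h.1).isClosed_biUnion fun t _ =>
      (t.finite_toSet.isCompact_convexHull ℝ).isClosed
  have hcover : K.space ⊆ (⋃ t ∈ {t ∈ simplices K 3 | S t}, convexHull ℝ (t : Set E3)) ∪
      ⋃ t ∈ {t ∈ simplices K 3 | ¬ S t}, convexHull ℝ (t : Set E3) := by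
    intro x hx
    obtain ⟨u, hu, hxu⟩ := SimplicialComplex.mem_space_iff.mp hx
    obtain ⟨t, ht, hut⟩ := hK.pure u hu
    have hxt := convexHull_mono (Finset.coe_subset.mpr hut) hxu
    by_cases h : S t
    · exact Or.inl (Set.mem_biUnion (show t ∈ {t ∈ simplices K 3 | S t} from ⟨ht, h⟩) hxt)
    · exact Or.inr (Set.mem_biUnion (show t ∈ {t ∈ simplices K 3 | ¬ S t} from ⟨ht, h⟩) hxt)
  have hmeet : ∀ Q : Finset E3 → Prop, ∀ t ∈ simplices K 3, Q t →
      (K.space ∩ ⋃ t ∈ {t ∈ simplices K 3 | Q t}, convexHull ℝ (t : Set E3)).Nonempty := by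
    intro Q t ht h
    obtain ⟨v, hv⟩ := SimplicialComplex.nonempty_of_mem_faces ht.1
    exact ⟨v, SimplicialComplex.subset_space ht.1 hv,
      Set.mem_biUnion (show t ∈ {t ∈ simplices K 3 | Q t} from ⟨ht, h⟩)
        (subset_convexHull ℝ _ hv)⟩
  -- Connectedness yields a point on triangles of both kinds; in a simplicial complex these then
  -- share a vertex.
  obtain ⟨x, -, hx1, hx2⟩ := isPreconnected_closed_iff.mp hK.connected.isPreconnected _ _
    (hclosed S) (hclosed fun t => ¬ S t) hcover (hmeet S s₀ hs₀ hSs) (hmeet _ t₀ ht₀ hSt)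
  obtain ⟨s, ⟨hs, hSs'⟩, hxs⟩ := Set.mem_iUnion₂.mp hx1
  obtain ⟨t, ⟨ht, hSt'⟩, hxt⟩ := Set.mem_iUnion₂.mp hx2
  have hxst := K.inter_subset_convexHull hs.1 ht.1 ⟨hxs, hxt⟩
  obtain ⟨v, hvs, hvt⟩ := convexHull_nonempty_iff.mp ⟨x, hxst⟩
  exact hSt' (hvertex v s hs t ht hvs hvt hSs')

/-- Moving along edges, one reaches all vertices of a closed surface. -/
theorem vertices_connected (hK : IsClosedSurface K) (S : E3 → Prop)
    (hS : ∀ v w, {v, w} ∈ simplices K 2 → (S v ↔ S w)) :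
    ∀ v ∈ K.vertices, ∀ w ∈ K.vertices, S v → S w := by
  have htri : ∀ t ∈ simplices K 3, ∀ v ∈ t, ∀ w ∈ t, (S v ↔ S w) := by
    intro t ht v hv w hw
    by_cases hvw : v = w
    · rw [hvw]
    · refine hS v w ⟨K.down_closed ht.1 ?_ ⟨v, by simp⟩, Finset.card_pair hvw⟩
      intro z hz
      rcases Finset.mem_insert.mp hz with rfl | hz
      · exact hv
      · exact Finset.mem_singleton.mp hz ▸ hw
  intro v hv w hw hSv
  obtain ⟨s, hs, hvs⟩ := hK.pure _ hv
  obtain ⟨t, ht, hwt⟩ := hK.pure _ hw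
  rw [Finset.singleton_subset_iff] at hvs hwt
  refine hK.dual_connected (fun t => ∀ z ∈ t, S z) ?_ s hs t ht
    (fun z hz => (htri s hs v hvs z hz).mp hSv) w hwt
  rintro s hs t ht ⟨e, he, hes, het⟩
  obtain ⟨z, hz⟩ : e.Nonempty := Finset.card_pos.mp (by omega)
  exact ⟨fun h y hy => (htri t ht z (het hz) y hy).mp (h z (hes hz)),
    fun h y hy => (htri s hs z (hes hz) y hy).mp (h z (het hz))⟩

/-- The two triangles at an edge. -/
theorem exists_sides (hK : IsClosedSurface K) {e : Finset E3} (he : e ∈ simplices K 2) :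
    ∃ l ∈ simplices K 3, ∃ r ∈ simplices K 3, l ≠ r ∧
      ∀ t ∈ simplices K 3, e ⊆ t ↔ l = t ∨ r = t := by
  obtain ⟨l, r, hlr, h⟩ := Set.ncard_eq_two.mp (hK.edge e he)
  have hmem : ∀ t, (t ∈ simplices K 3 ∧ e ⊆ t) ↔ t = l ∨ t = r := fun t => by
    simpa using Set.ext_iff.mp h t
  refine ⟨l, ((hmem l).mpr (.inl rfl)).1, r, ((hmem r).mpr (.inr rfl)).1, hlr, fun t ht => ?_⟩
  have := hmem t
  simp only [eq_comm (a := l), eq_comm (a := r), ← this, ht, true_and]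

end IsClosedSurface

/-- Each vertex of a triangle lies in exactly two of its edges. -/
theorem sum_powersetCard_two_sum {α M : Type*} [DecidableEq α] [AddCommMonoid M] {t : Finset α}
    (ht : t.card = 3) (φ : α → M) :
    ∑ e ∈ t.powersetCard 2, ∑ v ∈ e, φ v = 2 • ∑ v ∈ t, φ v := by
  obtain ⟨x, y, z, hxy, hxz, hyz, rfl⟩ := Finset.card_eq_three.mp ht
  have h1 : ({x, y} : Finset α) ≠ {x, z} := fun h => by
    simpa [hxy.symm, hyz] using Finset.ext_iff.mp h y
  have h2 : ({x, y} : Finset α) ≠ {y, z} := fun h => by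
    simpa [hxy, hxz] using Finset.ext_iff.mp h x
  have h3 : ({x, z} : Finset α) ≠ {y, z} := fun h => by
    simpa [hxy, hxz] using Finset.ext_iff.mp h x
  have h : ({x, y, z} : Finset α).powersetCard 2 = {{x, y}, {x, z}, {y, z}} := by
    symm
    refine Finset.eq_of_subset_of_card_le ?_ ?_
    · intro e he
      simp only [Finset.mem_insert, Finset.mem_singleton] at he
      rw [Finset.mem_powersetCard]
      rcases he with rfl | rfl | rfl
      · exact ⟨by grind, Finset.card_pair hxy⟩
      · exact ⟨by grind, Finset.card_pair hxz⟩
      · exact ⟨by grind, Finset.card_pair hyz⟩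
    · rw [Finset.card_powersetCard, ht, Finset.card_eq_three.mpr ⟨_, _, _, h1, h2, h3, rfl⟩]
      decide
  rw [h, Finset.sum_insert (by simp [h1, h2]), Finset.sum_pair h3, Finset.sum_pair hxy,
    Finset.sum_pair hxz, Finset.sum_pair hyz, Finset.sum_insert (by simp [hxy, hxz]),
    Finset.sum_pair hyz, two_nsmul]
  abel

/-- The boundary of the coboundary of a vertex function vanishes modulo two. -/
theorem sum_edges_eq_zero [Fintype (simplices K 2)] {t : Finset E3}
    (ht : t ∈ simplices K 3) [DecidablePred fun e : simplices K 2 => e.1 ⊆ t]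
    (φ : E3 → ZMod 2) :
    ∑ e : simplices K 2, (if e.1 ⊆ t then ∑ v ∈ e.1, φ v else 0) = 0 := by
  classical
  rw [← Finset.sum_filter]
  have h : ∑ e ∈ t.powersetCard 2, ∑ v ∈ e, φ v = 0 := by
    rw [sum_powersetCard_two_sum ht.2, CharTwo.two_nsmul]
  refine Eq.trans (Finset.sum_bij (fun e _ => e.1) (fun e he => ?_) (fun _ _ _ _ => Subtype.ext)
    (fun e he => ?_) (fun _ _ => rfl)) h
  · exact Finset.mem_powersetCard.mpr ⟨(Finset.mem_filter.mp he).2, e.2.2⟩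
  · obtain ⟨h1, h2⟩ := Finset.mem_powersetCard.mp he
    exact ⟨⟨e, K.down_closed ht.1 h1 (Finset.card_pos.mp (by omega)), h2⟩,
      Finset.mem_filter.mpr ⟨Finset.mem_univ _, h1⟩, rfl⟩

theorem ncard_simplices_one : (simplices K 1).ncard = K.vertices.ncard := by
  have : simplices K 1 = (fun v => ({v} : Finset E3)) '' K.vertices := by
    ext s
    constructor
    · rintro ⟨hs, hc⟩
      obtain ⟨v, rfl⟩ := Finset.card_eq_one.mp hc
      exact ⟨v, hs, rfl⟩
    · rintro ⟨v, hv, rfl⟩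
      exact ⟨hv, Finset.card_singleton v⟩
  rw [this, Set.ncard_image_of_injective _ (Finset.singleton_injective)]

end SnappingFixture

/-! ### Facets as parts of the dual graph -/

namespace SnappingFixture

namespace Polyhedron

variable {P : Polyhedron}

theorem subset_simplices_of_facet (f : P.Facet) : f.1 ⊆ simplices P.bd 3 :=
  P.sUnion_facets ▸ Set.subset_sUnion_of_mem f.2

instance finite_facet (P : Polyhedron) : Finite P.Facet := by
  have h : P.facets ⊆ (simplices P.bd 3).powerset := fun f hf =>
    subset_simplices_of_facet ⟨f, hf⟩
  exact ((P.isClosedSurface.finite_simplices 3).finite_subsets.subset h).to_subtype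

theorem facet_eq_of_mem {f f' : P.Facet} {t : Finset E3} (h : t ∈ f.1) (h' : t ∈ f'.1) :
    f = f' := by
  by_contra hne
  exact Set.disjoint_left.mp
    (P.pairwiseDisjoint_facets f.2 f'.2 fun h => hne (Subtype.ext h)) h h'

theorem exists_facet_mem {t : Finset E3} (ht : t ∈ simplices P.bd 3) : ∃ f : P.Facet, t ∈ f.1 := by
  rw [← P.sUnion_facets] at ht
  obtain ⟨f, hf, htf⟩ := ht
  exact ⟨⟨f, hf⟩, htf⟩

end Polyhedron

open Polyhedron in
/-- If each of three facets is a neighbor of all facets in a set `J`, then `J` has at most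
`4 g + 2` elements. -/
theorem Polyhedron.card_common_neighbors_le (P : Polyhedron) (g : ℕ) (hg : P.HasGenus g)
    (B : Fin 3 → P.Facet) (hB : Function.Injective B) (J : Set P.Facet)
    (hJ : ∀ q ∈ J, ∀ i, q.Neighbor (B i)) : J.ncard ≤ 4 * g + 2 := by
  classical
  have hK := P.isClosedSurface
  have : Finite (P.bd.vertices) := by
    refine (Set.Finite.subset ?_ (fun v hv => hv) : (P.bd.vertices).Finite).to_subtype
    exact hK.finite.preimage Finset.singleton_injective.injOn
  have : Fintype P.bd.vertices := Fintype.ofFinite _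
  have : Finite (simplices P.bd 2) := (hK.finite_simplices 2).to_subtype
  have : Fintype (simplices P.bd 2) := Fintype.ofFinite _
  have : Finite (simplices P.bd 3) := (hK.finite_simplices 3).to_subtype
  have : Fintype (simplices P.bd 3) := Fintype.ofFinite _
  have : Fintype J := Fintype.ofFinite J
  choose a b hab hends using fun e : simplices P.bd 2 => Finset.card_eq_two.mp e.2.2
  have hvert : ∀ e : simplices P.bd 2, ∀ v ∈ e.1, v ∈ P.bd.vertices := fun e v hv =>
    P.bd.down_closed e.2.1 (Finset.singleton_subset_iff.mpr hv) (Finset.singleton_nonempty v)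
  have ha : ∀ e, a e ∈ P.bd.vertices := fun e => hvert e _ (by rw [hends]; simp)
  have hb : ∀ e, b e ∈ P.bd.vertices := fun e => hvert e _ (by rw [hends]; simp)
  choose l hl r hr hlr hsides using fun e : simplices P.bd 2 => hK.exists_sides e.2
  let l' : simplices P.bd 2 → simplices P.bd 3 := fun e => ⟨l e, hl e⟩
  let r' : simplices P.bd 2 → simplices P.bd 3 := fun e => ⟨r e, hr e⟩
  have hshare : ∀ s t : simplices P.bd 3, s ≠ t → SharesEdge s.1 t.1 →
      ∃ e, (l' e = s ∧ r' e = t) ∨ (l' e = t ∧ r' e = s) := by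
    rintro s t hst ⟨e, he, hes, het⟩
    have heK : e ∈ simplices P.bd 2 :=
      ⟨P.bd.down_closed s.2.1 hes (Finset.card_pos.mp (by omega)), he⟩
    refine ⟨⟨e, heK⟩, ?_⟩
    rcases (hsides ⟨e, heK⟩ s s.2).mp hes with h1 | h1 <;>
      rcases (hsides ⟨e, heK⟩ t t.2).mp het with h2 | h2
    · exact absurd (Subtype.ext (h1.symm.trans h2)) hst
    · exact Or.inl ⟨Subtype.ext h1, Subtype.ext h2⟩
    · exact Or.inr ⟨Subtype.ext h2, Subtype.ext h1⟩
    · exact absurd (Subtype.ext (h1.symm.trans h2)) hst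
  choose fac hfac using fun t : simplices P.bd 3 => exists_facet_mem t.2
  have hfac_eq : ∀ t f, t.1 ∈ f.1 → fac t = f := fun t f h => facet_eq_of_mem (hfac t) h
  let F : Fin 3 ⊕ J → P.Facet := Sum.elim B Subtype.val
  have hF : Function.Injective F :=
    hB.sumElim Subtype.val_injective fun i q h => (hJ q q.2 i).1 h.symm
  let p : simplices P.bd 3 → Option (Fin 3 ⊕ J) := fun t =>
    if h : ∃ i, F i = fac t then some h.choose else none
  have hp : ∀ t i, p t = some i ↔ fac t = F i := by
    intro t i
    by_cases h : ∃ i, F i = fac t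
    · simp only [p, h, dif_pos, Option.some.injEq]
      exact ⟨fun hi => hi ▸ h.choose_spec.symm, fun hi => hF (h.choose_spec.trans hi)⟩
    · simp only [p, h, dif_neg, not_false_iff, reduceCtorEq, false_iff]
      exact fun hi => h ⟨i, hi.symm⟩
  have key := card_le_of_dual_completeBipartite_minor (J := J)
    (fun e => (⟨a e, ha e⟩ : P.bd.vertices)) (fun e => ⟨b e, hb e⟩) l' r' g ?_ ?_ ?_ ?_ p ?_ ?_
  · rwa [← Nat.card_eq_fintype_card, Nat.card_coe_set_eq] at key
  · rw [← Nat.card_eq_fintype_card, ← Nat.card_eq_fintype_card, ← Nat.card_eq_fintype_card,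
      Nat.card_coe_set_eq, Nat.card_coe_set_eq, Nat.card_coe_set_eq, ← ncard_simplices_one]
    exact hg
  · intro S hS v w hv
    have := hK.vertices_connected (fun z => ∃ hz, S ⟨z, hz⟩) ?_ v v.2 w w.2 ⟨v.2, hv⟩
    · exact this.2
    · intro v w hvw
      have h := hS ⟨{v, w}, hvw⟩
      have hpair : ({v, w} : Finset E3) = {a ⟨_, hvw⟩, b ⟨_, hvw⟩} := hends ⟨_, hvw⟩
      have h' : (∃ hz, S ⟨a ⟨_, hvw⟩, hz⟩) ↔ ∃ hz, S ⟨b ⟨_, hvw⟩, hz⟩ :=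
        ⟨fun ⟨_, h1⟩ => ⟨hb _, h.mp h1⟩, fun ⟨_, h1⟩ => ⟨ha _, h.mpr h1⟩⟩
      have hv : v = a ⟨_, hvw⟩ ∨ v = b ⟨_, hvw⟩ := by
        simpa using (Finset.ext_iff.mp hpair v).mp (by simp)
      have hw : w = a ⟨_, hvw⟩ ∨ w = b ⟨_, hvw⟩ := by
        simpa using (Finset.ext_iff.mp hpair w).mp (by simp)
      clear h hpair
      generalize a ⟨{v, w}, hvw⟩ = x at h' hv hw
      generalize b ⟨{v, w}, hvw⟩ = y at h' hv hw
      rcases hv with rfl | rfl <;> rcases hw with rfl | rfl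
      · rfl
      · exact h'
      · exact h'.symm
      · rfl
  · intro S hS s t hs
    refine (hK.dual_connected (fun z => ∃ hz, S ⟨z, hz⟩) ?_ s s.2 t t.2 ⟨s.2, hs⟩).2
    intro s hs t ht hst
    by_cases heq : s = t
    · rw [heq]
    · have h' : S ⟨s, hs⟩ ↔ S ⟨t, ht⟩ := by
        obtain ⟨e, ⟨h1, h2⟩ | ⟨h1, h2⟩⟩ :=
          hshare ⟨s, hs⟩ ⟨t, ht⟩ (fun h => heq (congrArg Subtype.val h)) hst
        · rw [← h1, ← h2]; exact hS e
        · rw [← h1, ← h2]; exact (hS e).symm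
      exact ⟨fun ⟨_, h⟩ => ⟨ht, h'.mp h⟩, fun ⟨_, h⟩ => ⟨hs, h'.mpr h⟩⟩
  · intro φ t
    -- The value off the vertex set is irrelevant, since edges end at vertices.
    let ψ : E3 → ZMod 2 := fun v => if h : v ∈ P.bd.vertices then φ ⟨v, h⟩ else 0
    refine Eq.trans (Finset.sum_congr rfl fun e _ => ?_) (sum_edges_eq_zero t.2 ψ)
    have hsum : ∑ v ∈ e.1, ψ v = φ ⟨a e, ha e⟩ + φ ⟨b e, hb e⟩ := by
      rw [hends, Finset.sum_pair (hab e)]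
      simp only [ψ, ha, hb, dif_pos]
    rw [hsum, if_congr (hsides e t t.2) rfl rfl]
    have h1 : l' e = t ↔ l e = t := Subtype.ext_iff
    have h2 : r' e = t ↔ r e = t := Subtype.ext_iff
    rw [if_congr h1 rfl rfl, if_congr h2 rfl rfl]
    -- As `l e ≠ r e`, the sum of the two indicators is the indicator of their disjunction.
    by_cases hlt : l e = t
    · have hrt : r e ≠ t := fun h => hlr e (hlt.trans h.symm)
      simp [hlt, hrt]
    · by_cases hrt : r e = t <;> simp [hlt, hrt]
  · intro i S hS s t hs ht hSs
    rw [hp] at hs ht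
    have hchain := P.edgeConnected_of_facet (F i).1 (F i).2 s (hs ▸ hfac s) t (ht ▸ hfac t)
    suffices ∀ u, Relation.ReflTransGen
        (fun c d => c ∈ (F i).1 ∧ d ∈ (F i).1 ∧ SharesEdge c d) s.1 u → ∃ hu, S ⟨u, hu⟩ from
      (this _ hchain).2
    intro u hu
    induction hu with
    | refl => exact ⟨s.2, hSs⟩
    | @tail c d _ hcd ih =>
      obtain ⟨hc, hSc⟩ := ih
      have hd := subset_simplices_of_facet (F i) hcd.2.1
      refine ⟨hd, ?_⟩
      -- A chain may repeat a triangle, since a triangle shares an edge with itself.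
      by_cases heq : c = d
      · subst heq; exact hSc
      · have hpc : p ⟨c, hc⟩ = some i := (hp _ _).mpr (hfac_eq _ _ hcd.1)
        have hpd : p ⟨d, hd⟩ = some i := (hp _ _).mpr (hfac_eq _ _ hcd.2.1)
        obtain ⟨e, ⟨h1, h2⟩ | ⟨h1, h2⟩⟩ :=
          hshare ⟨c, hc⟩ ⟨d, hd⟩ (fun h => heq (congrArg Subtype.val h)) hcd.2.2
        · rw [← h2]
          exact (hS e (h1 ▸ hpc) (h2 ▸ hpd)).mp (h1 ▸ hSc)
        · rw [← h1]
          exact (hS e (h1 ▸ hpd) (h2 ▸ hpc)).mpr (h2 ▸ hSc)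
  · intro i q
    obtain ⟨hne, s, hs, t, ht, hst⟩ := hJ q q.2 i
    have hsK := subset_simplices_of_facet _ hs
    have htK := subset_simplices_of_facet _ ht
    have hps : p ⟨s, hsK⟩ = some (.inr q) := (hp _ _).mpr (hfac_eq _ _ hs)
    have hpt : p ⟨t, htK⟩ = some (.inl i) := (hp _ _).mpr (hfac_eq _ _ ht)
    obtain ⟨e, ⟨h1, h2⟩ | ⟨h1, h2⟩⟩ := hshare ⟨s, hsK⟩ ⟨t, htK⟩
      (fun h => hne (facet_eq_of_mem hs (Subtype.mk.inj h ▸ ht))) hst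
    · exact ⟨e, .inr ⟨h1 ▸ hps, h2 ▸ hpt⟩⟩
    · exact ⟨e, .inl ⟨h1 ▸ hpt, h2 ▸ hps⟩⟩

end SnappingFixture

theorem mainTheorem3 (P : SnappingFixture.Polyhedron) (g : ℕ) (hg : P.HasGenus g)
    (τ : Fin 3 → P.Finger) (hτ : ∀ i, (τ i).IsCandidate)
    (hbody : Function.Injective fun i => (τ i).body) :
    (SnappingFixture.Polyhedron.commonPalms τ).Finite ∧
      (SnappingFixture.Polyhedron.commonPalms τ).ncard ≤ 4 * g + 2 :=
  ⟨Set.toFinite _, P.card_common_neighbors_le g hg _ hbody _ fun _ hp i => (hp i).1⟩
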